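/- **Theorem 4.** Let $\mathbb{F}$ be a finite field. An $(n,k,\ell)_{\mathbb{F}}$ MDS array code is a code of length $n$ over the alphabet $\mathbb{F}^\ell$ with $|\mathbb{F}|^{\ell k}$ codewords in which each codeword is determined by any $k$ of its $n$ symbols (its $i$-th symbol is the content of node $i$). For $\varepsilon>0$, such a code has the $(h,d)$ $\varepsilon$-optimal help-by-transfer property if the contents of any $h$ failed nodes can be recovered with the help of any $d$ other nodes, where each helper node transmits at most $(1+\varepsilon)\frac{h\ell}{d-k+h}$ of the $\ell$ symbols over $\mathbb{F}$ that it stores (a fixed subset of its stored symbols that depends only on the code and on the sets of failed and helper nodes). Let $r\ge 1$ be an integer and $\varepsilon>0$ a real number. Then there are a constant $\theta=\theta(r,\varepsilon)>0$ and constants $c>0$ and $K$, depending only on $r$ and $\varepsilon$, such that for infinitely many $\ell$ there are integers $n\ge c\,e^{\theta\ell}$ and $k=n-r\ge1$ for which the following holds. There exists, over some finite field $\mathbb{F}$ with $|\mathbb{F}|\le Kn$, and also over every finite field $\mathbb{F}$ with $|\mathbb{F}|\ge Kn$, a linear $(n,k,\ell)_{\mathbb{F}}$ MDS array code that has the $(h,d)$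 $\varepsilon$-optimal help-by-transfer property simultaneously for all $1\le h\le r$ and $k\le d\le n-h$. -/

import Mathlib

/-- `C`, a set of words of length `n` over the alphabet `F^ℓ`, is an `(n, k, ℓ)` MDS array code
over `F`: it has `|F| ^ (ℓ * k)` codewords, and each codeword is determined by any `k` of its `n`
code symbols. -/
def IsMDSArrayCode {F : Type} {n ℓ : ℕ} (k : ℕ) (C : Set (Fin n → Fin ℓ → F)) : Prop :=
  Nat.card C = Nat.card F ^ (ℓ * k) ∧
  ∀ S : Finset (Fin n), S.card = k → ∀ c ∈ C, ∀ c' ∈ C, (∀ j ∈ S, c j = c' j) → c = c'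

/-- The nodes in `failed` can be repaired, for every codeword of `C`, when each helper node
`j ∈ helpers` transmits exactly those of its `ℓ` stored symbols that are indexed by `T j`:
a decoder `R` computes the contents of all failed nodes from the transmitted symbols alone. -/
def RepairsByTransfer {F : Type} {n ℓ : ℕ} (C : Set (Fin n → Fin ℓ → F))
    (failed helpers : Finset (Fin n)) (T : Fin n → Finset (Fin ℓ)) : Prop :=
  ∃ R : ((j : {j // j ∈ helpers}) → {a // a ∈ T j.1} → F) → Fin n → Fin ℓ → F,
    ∀ c ∈ C, ∀ i ∈ failed, R (fun j a => c j.1 a.1) i = c i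

/-- The `(h, d)` `ε`-optimal help-by-transfer property of an `(n, k, ℓ)` array code: any `h` failed
nodes can be repaired with the help of any `d` of the other nodes, where each helper node transmits
a subset of at most `(1 + ε) h ℓ / (d - k + h)` of its stored symbols. -/
def HasHelpByTransfer {F : Type} {n ℓ : ℕ} (k : ℕ) (C : Set (Fin n → Fin ℓ → F))
    (ε : ℝ) (h d : ℕ) : Prop :=
  ∀ failed helpers : Finset (Fin n), failed.card = h → helpers.card = d →
    Disjoint failed helpers →
    ∃ T : Fin n → Finset (Fin ℓ),
      (∀ j ∈ helpers,
        ((T j).card : ℝ) ≤ (1 + ε) * ((h : ℝ) * (ℓ : ℝ) / ((d : ℝ) - (k : ℝ) + (h : ℝ)))) ∧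
      RepairsByTransfer C failed helpers T

/-- There is a linear `(n, k, ℓ)` MDS array code over `F` which has the `(h, d)` `ε`-optimal
help-by-transfer property simultaneously for all `1 ≤ h ≤ n - k` and `k ≤ d ≤ n - h`. -/
def ExistsSimultaneousCode (F : Type) [Field F] (n k ℓ : ℕ) (ε : ℝ) : Prop :=
  ∃ C : Submodule F (Fin n → Fin ℓ → F),
    IsMDSArrayCode k (C : Set (Fin n → Fin ℓ → F)) ∧
    ∀ h d : ℕ, 1 ≤ h → h ≤ n - k → k ≤ d → d ≤ n - h →
      HasHelpByTransfer k (C : Set (Fin n → Fin ℓ → F)) ε h d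

/-! Give each of the `n = 2 ^ m` nodes a word of length `m` over `N` colours, any two words agreeing
in few places. A coordinate is a place `t` with a digit vector `a`, which has for every colour one
digit of each alphabet size `1, …, r`. At each coordinate the code imposes `r` Vandermonde checks,
and the evaluation point of a node depends only on the digits of its own colour at `t`. Distinct
points give the MDS property.

To repair node `i`, sum the checks over a digit of size `s + 1` of its colour. A node of another
colour keeps its point and enters through one digit sum, while `i` contributes `s + 1` unknowns with
distinct points. This is solvable if at most `r - (s + 1)` other sums are unknown (`repair_single`).
Failed nodes are repaired in turn with `s = d - k + p`, each repaired node freeing one unknown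
(`repair_block`).

Each node stores face sums instead of raw symbols. Those at vectors with some chosen digit zero
determine all needed digit sums, and their fraction telescopes to `h / (d - k + h)`
(`card_exists_digit_eq_zero`). At the few places with colour clashes helpers send everything, at
relative cost at most `ε`. The number of digit vectors is constant, so `n` is exponential in `ℓ`. -/

namespace HelpByTransfer

/-! ### Words with few agreements, and counting digit vectors. -/

section Combinatorics

/-- Greedy packing: if every `R`-neighbourhood has at most `V` points and `k * V ≤ |X|`, there are
`k` points that are pairwise not related. -/
theorem exists_packing {X : Type*} [Fintype X] [DecidableEq X] (R : X → X → Prop)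
    [DecidableRel R] (hrefl : ∀ x, R x x) (hsymm : ∀ x y, R x y → R y x) (V : ℕ)
    (hV : ∀ x, (Finset.univ.filter (R x)).card ≤ V) (hV0 : 0 < V) (k : ℕ)
    (hk : k * V ≤ Fintype.card X) :
    ∃ S : Finset X, S.card = k ∧ ∀ x ∈ S, ∀ y ∈ S, x ≠ y → ¬ R x y := by
  induction k with
  | zero => exact ⟨∅, by simp, by simp⟩
  | succ k ih =>
    have hlt : k * V < Fintype.card X := by nlinarith
    obtain ⟨S, hS, hR⟩ := ih hlt.le
    have hcov : (S.biUnion fun x => Finset.univ.filter (R x)).card < Fintype.card X := by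
      refine lt_of_le_of_lt (Finset.card_biUnion_le_card_mul _ _ V fun x _ => hV x) ?_
      rwa [hS]
    obtain ⟨z, hz⟩ : ∃ z, z ∉ S.biUnion fun x => Finset.univ.filter (R x) := by
      by_contra! hall
      rw [Finset.eq_univ_iff_forall.2 hall, Finset.card_univ] at hcov
      exact lt_irrefl _ hcov
    have hz' : ∀ x ∈ S, ¬ R x z := by
      intro x hx hxz
      exact hz (Finset.mem_biUnion.2 ⟨x, hx, by simpa using hxz⟩)
    have hzS : z ∉ S := fun h => hz' z h (hrefl z)
    refine ⟨insert z S, by rw [Finset.card_insert_of_notMem hzS, hS], ?_⟩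
    intro x hx y hy hxy
    rcases Finset.mem_insert.1 hx with rfl | hxS <;> rcases Finset.mem_insert.1 hy with rfl | hyS
    · exact absurd rfl hxy
    · exact fun h => hz' y hyS (hsymm _ _ h)
    · exact hz' x hxS
    · exact hR x hxS y hyS hxy

theorem card_agree_on {m N : ℕ} (x : Fin m → Fin N) (S : Finset (Fin m)) :
    (Finset.univ.filter fun y : Fin m → Fin N => ∀ t ∈ S, x t = y t).card = N ^ (m - S.card) := by
  have : (Finset.univ.filter fun y : Fin m → Fin N => ∀ t ∈ S, x t = y t)
      = Fintype.piFinset fun t => if t ∈ S then {x t} else Finset.univ := by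
    ext y
    simp only [Finset.mem_filter, Finset.mem_univ, true_and, Fintype.mem_piFinset]
    refine forall_congr' fun t => ?_
    by_cases h : t ∈ S <;> simp [h, eq_comm]
  rw [this, Fintype.card_piFinset]
  have h2 : ∀ t, (if t ∈ S then ({x t} : Finset (Fin N)) else Finset.univ).card
      = if t ∈ S then 1 else N := by
    intro t; by_cases h : t ∈ S <;> simp [h]
  simp only [h2, Finset.prod_ite, Finset.prod_const_one, one_mul, Finset.prod_const]
  congr 1
  rw [show (Finset.univ.filter fun t => t ∉ S) = Sᶜ by ext; simp, Finset.card_compl,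
    Fintype.card_fin]

/-- Union bound over the `M`-sets of agreement places, of which there are at most `2 ^ m`. -/
theorem card_agree_ball_le {m N M : ℕ} (x : Fin m → Fin N) :
    (Finset.univ.filter fun y : Fin m → Fin N =>
      M ≤ (Finset.univ.filter fun t => x t = y t).card).card ≤ 2 ^ m * N ^ (m - M) := by
  have hsub : (Finset.univ.filter fun y : Fin m → Fin N =>
      M ≤ (Finset.univ.filter fun t => x t = y t).card) ⊆
      (Finset.powersetCard M (Finset.univ : Finset (Fin m))).biUnion fun S =>
        Finset.univ.filter fun y : Fin m → Fin N => ∀ t ∈ S, x t = y t := by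
    intro y hy
    obtain ⟨S, hS, hSM⟩ := Finset.exists_subset_card_eq (Finset.mem_filter.1 hy).2
    refine Finset.mem_biUnion.2 ⟨S, Finset.mem_powersetCard.2 ⟨Finset.subset_univ _, hSM⟩, ?_⟩
    exact Finset.mem_filter.2 ⟨Finset.mem_univ _, fun t ht => (Finset.mem_filter.1 (hS ht)).2⟩
  refine (Finset.card_le_card hsub).trans ?_
  refine (Finset.card_biUnion_le_card_mul _ _ (N ^ (m - M)) ?_).trans ?_
  · intro S hS
    rw [card_agree_on, (Finset.mem_powersetCard.1 hS).2]
  · refine Nat.mul_le_mul_right _ ?_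
    calc _ ≤ (Finset.powerset (Finset.univ : Finset (Fin m))).card :=
          Finset.card_le_card (by
            intro S _; simp)
      _ = 2 ^ m := by simp

/-- A code with `2 ^ (b * M)` words of length `b * M` over an alphabet of size `4 ^ b`, two distinct
words of which agree in fewer than `M` places. -/
theorem exists_code_few_agreements (b M : ℕ) (hb : 1 ≤ b) :
    ∃ w : Fin (2 ^ (b * M)) → Fin (b * M) → Fin (4 ^ b), ∀ j j', j ≠ j' →
      (Finset.univ.filter fun t => w j t = w j' t).card < M := by
  have hMm : M ≤ b * M := Nat.le_mul_of_pos_left _ hb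
  obtain ⟨S, hS, hR⟩ := exists_packing
    (X := Fin (b * M) → Fin (4 ^ b))
    (fun x y => M ≤ (Finset.univ.filter fun t => x t = y t).card)
    (by intro x; simpa using hMm)
    (by intro x y h; simpa [eq_comm] using h)
    -- With this ball bound, `2 ^ (b * M)` balls use up exactly the size `(4 ^ b) ^ (b * M)` of the
    -- space.
    (2 ^ (b * M) * (4 ^ b) ^ (b * M - M)) (fun x => card_agree_ball_le x) (by positivity)
    (2 ^ (b * M)) (by
      rw [← mul_assoc, ← mul_pow, show 2 * 2 = 4 by norm_num, pow_mul 4 b M, ← pow_add,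
        Nat.add_sub_cancel' hMm]
      simp)
  refine ⟨fun j => ((S.equivFinOfCardEq hS).symm j).1, fun j j' hjj => ?_⟩
  refine not_le.1 (hR _ (Subtype.property _) _ (Subtype.property _) fun h => hjj ?_)
  exact (S.equivFinOfCardEq hS).symm.injective (Subtype.ext h)

variable {G : Type*} [Fintype G] [DecidableEq G] {κ : G → ℕ}

/-- The digit vectors one of whose chosen digits vanishes, for chosen digits with alphabets of sizes
`q + 1, …, q + h`, form the fraction `h / (q + h)` of all digit vectors. -/
theorem card_exists_digit_eq_zero {h q : ℕ} (γ : Fin h → G) (hγ : Function.Injective γ)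
    (hκ : ∀ p, κ (γ p) = q + p.1) :
    (Finset.univ.filter fun a : (g : G) → Fin (κ g + 1) => ∃ p, a (γ p) = 0).card * (q + h)
      = h * Fintype.card ((g : G) → Fin (κ g + 1)) := by
  set A := Finset.univ.filter fun a : (g : G) → Fin (κ g + 1) => ∃ p, a (γ p) = 0 with hA
  -- The fraction of vectors with no chosen digit zero is the telescoping product of `(q + p) / (q +
  -- p + 1)`, that is `q / (q + h)`.
  have htel : (∏ p : Fin h, (q + p.1)) * (q + h) = (∏ p : Fin h, (q + p.1 + 1)) * q := by
    rw [Fin.prod_univ_eq_prod_range (fun p => q + p), Fin.prod_univ_eq_prod_range (fun p => q + p + 1),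
      ← Finset.prod_range_succ (fun p => q + p), Finset.prod_range_succ']
    simp [add_assoc]
  have hcompl : Aᶜ = Fintype.piFinset fun g =>
      if g ∈ Finset.univ.image γ then ({0}ᶜ : Finset (Fin (κ g + 1))) else Finset.univ := by
    ext a
    simp only [hA, Finset.mem_compl, Finset.mem_filter, Finset.mem_univ, true_and, not_exists,
      Fintype.mem_piFinset]
    constructor
    · intro H g
      split_ifs with hg
      · obtain ⟨p, -, rfl⟩ := Finset.mem_image.1 hg
        simpa using H p
      · simp
    · intro H p
      have := H (γ p)
      rw [if_pos (Finset.mem_image_of_mem _ (Finset.mem_univ _))] at this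
      simpa using this
  have hcard : Aᶜ.card = (∏ p : Fin h, (q + p.1)) *
      ∏ g ∈ (Finset.univ.image γ)ᶜ, (κ g + 1) := by
    rw [hcompl, Fintype.card_piFinset, ← Finset.prod_mul_prod_compl (Finset.univ.image γ)]
    congr 1
    · rw [Finset.prod_image (fun _ _ _ _ e => hγ e)]
      refine Finset.prod_congr rfl fun p _ => ?_
      rw [if_pos (Finset.mem_image_of_mem _ (Finset.mem_univ _)), Finset.card_compl]
      simp [hκ]
    · refine Finset.prod_congr rfl fun g hg => ?_
      rw [if_neg (Finset.mem_compl.1 hg)]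
      simp
  have htot : Fintype.card ((g : G) → Fin (κ g + 1)) = (∏ p : Fin h, (q + p.1 + 1)) *
      ∏ g ∈ (Finset.univ.image γ)ᶜ, (κ g + 1) := by
    rw [Fintype.card_pi, ← Finset.prod_mul_prod_compl (Finset.univ.image γ)]
    congr 1
    · rw [Finset.prod_image (fun _ _ _ _ e => hγ e)]
      simp [hκ]
    · simp
  have hsum := Finset.card_add_card_compl A
  have key : Aᶜ.card * (q + h) = q * Fintype.card ((g : G) → Fin (κ g + 1)) := by
    rw [hcard, htot, mul_right_comm, htel]; ring
  have e2 := congrArg (· * (q + h)) hsum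
  simp only [add_mul, key] at e2
  linarith

end Combinatorics

/-! ### Inverting sums over faces. -/

section FaceSum

variable {F : Type*} [Field F] {G : Type*} [Fintype G] [DecidableEq G] {κ : G → ℕ}

/-- The digit vectors that agree with `a` at all its nonzero digits. -/
def face (a : (g : G) → Fin (κ g + 1)) : Finset ((g : G) → Fin (κ g + 1)) :=
  Finset.univ.filter fun b => ∀ g, a g ≠ 0 → b g = a g

theorem mem_face {a b : (g : G) → Fin (κ g + 1)} : b ∈ face a ↔ ∀ g, a g ≠ 0 → b g = a g := by
  simp [face]

/-- The system is triangular: every other vector in the face of `a` has fewer zero digits. The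
predicate `P` allows restriction to the vectors with a given digit zero. -/
theorem eq_zero_of_face_sum_eq_zero (P : ((g : G) → Fin (κ g + 1)) → Prop) [DecidablePred P]
    (y : ((g : G) → Fin (κ g + 1)) → F)
    (hy : ∀ a, P a → ∑ b ∈ (face a).filter P, y b = 0) : ∀ a, P a → y a = 0 := by
  have main : ∀ z : ℕ, ∀ a, (Finset.univ.filter fun g => a g = 0).card = z → P a → y a = 0 := by
    intro z
    induction z using Nat.strong_induction_on with
    | _ z ih =>
      intro a hz ha
      have hmem : a ∈ (face a).filter P := by simp [mem_face, ha]
      rw [← hy a ha, eq_comm]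
      refine Finset.sum_eq_single_of_mem a hmem fun b hb hba => ?_
      obtain ⟨hb, hPb⟩ := Finset.mem_filter.1 hb
      rw [mem_face] at hb
      refine ih _ ?_ b rfl hPb
      rw [← hz]
      refine Finset.card_lt_card (Finset.ssubset_iff_subset_ne.2 ⟨?_, ?_⟩)
      · intro g hg
        simp only [Finset.mem_filter, Finset.mem_univ, true_and] at hg ⊢
        by_contra h
        exact h ((hb g h).symm.trans hg)
      · intro heq
        obtain ⟨g, hg⟩ := Function.ne_iff.1 hba
        have ha0 : a g = 0 := by
          by_contra h
          exact hg (hb g h)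
        have : g ∈ Finset.univ.filter fun g => b g = 0 := by rw [heq]; simpa using ha0
        simp only [Finset.mem_filter, Finset.mem_univ, true_and] at this
        exact hg (this.trans ha0.symm)
  exact fun a => main _ a rfl

theorem face_sum_eq (x : ((g : G) → Fin (κ g + 1)) → F) (a : (g : G) → Fin (κ g + 1)) (g : G)
    (ha : a g = 0) :
    ∑ b ∈ face a, x b
      = ∑ b ∈ (face a).filter (fun b => b g = 0), ∑ u, x (Function.update b g u) := by
  rw [← Finset.sum_product']
  refine Finset.sum_nbij' (fun b => (Function.update b g 0, b g))
    (fun z => Function.update z.1 g z.2) ?_ ?_ ?_ ?_ ?_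
  · intro b hb
    rw [mem_face] at hb
    simp only [Finset.mem_product, Finset.mem_filter, mem_face, Finset.mem_univ, and_true,
      Function.update_self]
    intro g' hg'
    have : g' ≠ g := by rintro rfl; exact hg' ha
    rw [Function.update_of_ne this, hb g' hg']
  · rintro ⟨b, u⟩ hb
    simp only [Finset.mem_product, Finset.mem_filter, mem_face, Finset.mem_univ, and_true] at hb
    rw [mem_face]
    intro g' hg'
    have : g' ≠ g := by rintro rfl; exact hg' ha
    simp only [Function.update_of_ne this, hb.1 g' hg']
  · intro b _
    simp
  · rintro ⟨b, u⟩ hb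
    simp only [Finset.mem_product, Finset.mem_filter, mem_face, Finset.mem_univ, and_true] at hb
    simp [← hb.2]
  · intro b _
    simp

theorem eq_zero_of_faceSum (x : ((g : G) → Fin (κ g + 1)) → F)
    (hx : ∀ a, ∑ b ∈ face a, x b = 0) : x = 0 := by
  funext a
  exact eq_zero_of_face_sum_eq_zero (fun _ => True) x (by simpa using hx) a trivial

/-- By `face_sum_eq`, face sums at vectors with digit `g` zero are restricted face sums of the digit
sums over `g`, so triangularity applies to the latter. Stored symbols thus replace digit sums for
several `g` at once. -/
theorem digit_sum_eq_zero_of_faceSum (x : ((g : G) → Fin (κ g + 1)) → F) (g : G)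
    (hx : ∀ a, a g = 0 → ∑ b ∈ face a, x b = 0) (a : (g : G) → Fin (κ g + 1)) :
    ∑ u, x (Function.update a g u) = 0 := by
  have := eq_zero_of_face_sum_eq_zero (fun a => a g = 0)
    (fun b => ∑ u, x (Function.update b g u))
    (fun a ha => by rw [← face_sum_eq x a g ha]; exact hx a ha) (Function.update a g 0) (by simp)
  simpa using this

end FaceSum

/-- Any `r` columns of a Vandermonde matrix with `r` rows are linearly independent. -/
theorem eq_zero_of_power_sums {F ι : Type*} [Field F] [Fintype ι] {r : ℕ} (x y : ι → F)
    (hx : Function.Injective x) (hr : Fintype.card ι ≤ r)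
    (h : ∀ e < r, ∑ i, x i ^ e * y i = 0) (i : ι) : y i = 0 := by
  classical
  -- This polynomial vanishes at every point but `x i`, so pairing it with `y` isolates `y i`.
  set p : Polynomial F := ∏ j ∈ Finset.univ.erase i, (Polynomial.X - Polynomial.C (x j)) with hp
  have hdeg : p.natDegree < r := by
    rw [hp, Polynomial.natDegree_prod_of_monic _ _ fun j _ => Polynomial.monic_X_sub_C _]
    simp only [Polynomial.natDegree_X_sub_C, Finset.sum_const, smul_eq_mul, mul_one,
      Finset.card_erase_of_mem (Finset.mem_univ i), Finset.card_univ]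
    have : 0 < Fintype.card ι := Fintype.card_pos_iff.2 ⟨i⟩
    omega
  have hsum : ∑ j, p.eval (x j) * y j = 0 := by
    simp_rw [Polynomial.eval_eq_sum_range' hdeg, Finset.sum_mul]
    rw [Finset.sum_comm]
    refine Finset.sum_eq_zero fun e he => ?_
    simp_rw [mul_assoc]
    rw [← Finset.mul_sum, h e (Finset.mem_range.1 he), mul_zero]
  rw [Finset.sum_eq_single i] at hsum
  · refine (mul_eq_zero.1 hsum).resolve_left ?_
    rw [hp, Polynomial.eval_prod]
    refine Finset.prod_ne_zero_iff.2 fun j hj => ?_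
    simpa [sub_eq_zero] using fun e => Finset.ne_of_mem_erase hj (hx e).symm
  · intro j _ hj
    rw [hp, Polynomial.eval_prod, Finset.prod_eq_zero (Finset.mem_erase.2 ⟨hj, Finset.mem_univ j⟩)
      (by simp), zero_mul]
  · simp

end HelpByTransfer

namespace HelpByTransfer

/-- Digit vectors with a digit of alphabet size `s + 1` for every colour and every `s < r`. -/
abbrev Digits (N r : ℕ) : Type := (g : Fin N × Fin r) → Fin (g.2.1 + 1)

/-- The digits of a single colour. -/
abbrev ColourDigits (r : ℕ) : Type := (s : Fin r) → Fin (s.1 + 1)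

/-! ### Linear criteria for the MDS property and for repair. -/

section General

variable {F : Type} [Field F] {n ℓ : ℕ}

theorem isMDSArrayCode_of_submodule [Finite F] {k : ℕ} (hk : k ≤ n)
    (C : Submodule F (Fin n → Fin ℓ → F)) (hC : ℓ * k ≤ Module.finrank F C)
    (hdet : ∀ S : Finset (Fin n), S.card = k → ∀ c ∈ C, (∀ j ∈ S, c j = 0) → c = 0) :
    IsMDSArrayCode k (C : Set (Fin n → Fin ℓ → F)) := by
  constructor
  · obtain ⟨S, -, hS⟩ := Finset.exists_subset_card_eq
      (show k ≤ (Finset.univ : Finset (Fin n)).card by simpa using hk)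
    have hle : Module.finrank F C ≤ ℓ * k := by
      let f : C →ₗ[F] ({j // j ∈ S} → Fin ℓ → F) :=
        (LinearMap.funLeft F (Fin ℓ → F) (fun j : {j // j ∈ S} => j.1)).comp C.subtype
      have hf : Function.Injective f := by
        rw [← LinearMap.ker_eq_bot, LinearMap.ker_eq_bot']
        intro c hc
        refine Subtype.ext (hdet S hS c.1 c.2 fun j hj => ?_)
        exact congrFun hc ⟨j, hj⟩
      have := LinearMap.finrank_le_finrank_of_injective hf
      rw [Module.finrank_pi_fintype] at this
      simp only [Module.finrank_fintype_fun_eq_card, Fintype.card_fin, Finset.sum_const,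
        Finset.card_univ, Fintype.card_coe, hS, smul_eq_mul] at this
      rwa [mul_comm]
    have := Module.natCard_eq_pow_finrank (K := F) (V := C)
    rw [le_antisymm hle hC] at this
    exact this
  · intro S hS c hc c' hc' h
    have := hdet S hS (c - c') (C.sub_mem hc hc') fun j hj => by simp [h j hj]
    exact sub_eq_zero.1 this

/-- The decoder may pick any codeword consistent with the transmitted symbols: by linearity, all of
them agree on the failed nodes. -/
theorem repairsByTransfer_of_submodule (C : Submodule F (Fin n → Fin ℓ → F))
    (failed helpers : Finset (Fin n)) (T : Fin n → Finset (Fin ℓ))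
    (h : ∀ c ∈ C, (∀ j ∈ helpers, ∀ a ∈ T j, c j a = 0) → ∀ i ∈ failed, c i = 0) :
    RepairsByTransfer (C : Set (Fin n → Fin ℓ → F)) failed helpers T := by
  classical
  refine ⟨fun y => if H : ∃ c ∈ C, (fun (j : {j // j ∈ helpers}) (a : {a // a ∈ T j.1}) =>
      c j.1 a.1) = y then H.choose else 0, fun c hc i hi => ?_⟩
  have H : ∃ c' ∈ C, (fun (j : {j // j ∈ helpers}) (a : {a // a ∈ T j.1}) => c' j.1 a.1)
      = fun j a => c j.1 a.1 := ⟨c, hc, rfl⟩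
  simp only [dif_pos H]
  have hmem := H.choose_spec.1
  have heq := H.choose_spec.2
  refine sub_eq_zero.1 (h (H.choose - c) (C.sub_mem hmem hc) (fun j hj a ha => ?_) i hi)
  have := congrFun (congrFun heq ⟨j, hj⟩) ⟨a, ha⟩
  simpa [sub_eq_zero] using this

end General

/-! ### The parity-check code, its repair and the repair cost. -/

variable {F : Type} [Field F] {n r N m : ℕ}

/-- The evaluation point of node `j` at the coordinate `b`. -/
def point (lam : Fin n × ColourDigits r → F) (w : Fin n → Fin m → Fin N) (j : Fin n)
    (b : Fin m × Digits N r) : F :=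
  lam (j, fun s => b.2 (w j b.1, s))

/-- The parity checks of the array code with diagonal parity check blocks. -/
def parityChecks (lam : Fin n × ColourDigits r → F) (w : Fin n → Fin m → Fin N) :
    (Fin n → Fin m × Digits N r → F) →ₗ[F] (Fin m × Digits N r → Fin r → F) where
  toFun c b e := ∑ j, point lam w j b ^ e.1 * c j b
  map_add' c c' := by
    funext b e
    simp [mul_add, Finset.sum_add_distrib]
  map_smul' z c := by
    funext b e
    simp only [Pi.smul_apply, smul_eq_mul, RingHom.id_apply, Finset.mul_sum]
    exact Finset.sum_congr rfl fun j _ => by ring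

theorem sum_eq_zero_of_mem_ker {lam : Fin n × ColourDigits r → F} {w : Fin n → Fin m → Fin N}
    {c : Fin n → Fin m × Digits N r → F} (hc : c ∈ LinearMap.ker (parityChecks lam w))
    (b : Fin m × Digits N r) {e : ℕ} (he : e < r) :
    ∑ j, point lam w j b ^ e * c j b = 0 :=
  congrFun (congrFun (LinearMap.mem_ker.1 hc) b) ⟨e, he⟩

/-- The unknown symbols at a coordinate can be found if there are at most `r` of them. -/
theorem eq_zero_of_erasures {lam : Fin n × ColourDigits r → F} (hlam : Function.Injective lam)
    {w : Fin n → Fin m → Fin N} {c : Fin n → Fin m × Digits N r → F}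
    (hc : c ∈ LinearMap.ker (parityChecks lam w)) (b : Fin m × Digits N r)
    (U : Finset (Fin n)) (hU : U.card ≤ r) (h : ∀ j, j ∉ U → c j b = 0) (i : Fin n) :
    c i b = 0 := by
  by_cases hi : i ∈ U
  · refine eq_zero_of_power_sums (fun j : {j // j ∈ U} => point lam w j.1 b) (fun j => c j.1 b)
      ?_ (by simpa using hU) (fun e he => ?_) ⟨i, hi⟩
    · intro j j' hjj
      exact Subtype.ext (congrArg Prod.fst (hlam hjj))
    · rw [← sum_eq_zero_of_mem_ker hc b he,
        Finset.sum_coe_sort U (fun j => point lam w j b ^ e * c j b)]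
      refine Finset.sum_subset (Finset.subset_univ _) fun j _ hj => ?_
      rw [h j hj, mul_zero]
  · exact h i hi

/-- Repair of a single node `i` from the sums over its digit of alphabet size `s + 1`, when at most
`r - (s + 1)` further nodes are unknown. -/
theorem repair_single {lam : Fin n × ColourDigits r → F} (hlam : Function.Injective lam)
    {w : Fin n → Fin m → Fin N} {c : Fin n → Fin m × Digits N r → F}
    (hc : c ∈ LinearMap.ker (parityChecks lam w)) (t : Fin m) (i : Fin n) (s : Fin r)
    (U : Finset (Fin n)) (hcard : U.card + (s.1 + 1) ≤ r)
    (hU : ∀ j ∈ U, w j t ≠ w i t)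
    (hknown : ∀ j, j ≠ i → j ∉ U → (∀ a, c j (t, a) = 0) ∨
      (w j t ≠ w i t ∧ ∀ a, ∑ u, c j (t, Function.update a (w i t, s) u) = 0))
    (a : Digits N r) : c i (t, a) = 0 := by
  have hiU : i ∉ U := fun h => hU i h rfl
  let up : Fin (s.1 + 1) → Digits N r := fun u => Function.update a (w i t, s) u
  have hpt : ∀ j, w j t ≠ w i t → ∀ u, point lam w j (t, up u) = point lam w j (t, a) := by
    intro j hj u
    unfold point
    congr 2
    funext s'
    refine Function.update_of_ne ?_ _ _
    intro h
    exact hj (congrArg Prod.fst h)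
  have hpti : ∀ u u', point lam w i (t, up u) = point lam w i (t, up u') → u = u' := by
    intro u u' h
    have := congrFun (congrArg Prod.snd (hlam h)) s
    simpa [up] using this
  -- The unknowns of the summed checks: the `s + 1` symbols of `i` and one digit sum for each node
  -- of `U`.
  let x : Fin (s.1 + 1) ⊕ {j // j ∈ U} → F :=
    Sum.elim (fun u => point lam w i (t, up u)) (fun j => point lam w j.1 (t, a))
  let y : Fin (s.1 + 1) ⊕ {j // j ∈ U} → F :=
    Sum.elim (fun u => c i (t, up u)) (fun j => ∑ u, c j.1 (t, up u))
  have hx : Function.Injective x := by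
    rintro (u | j) (u' | j') h
    · rw [hpti u u' h]
    · exact absurd (congrArg Prod.fst (hlam h)) fun e => hiU (by rw [show i = j'.1 from e]; exact j'.2)
    · exact absurd (congrArg Prod.fst (hlam h)) fun e => hiU (by rw [← show j.1 = i from e]; exact j.2)
    · exact congrArg Sum.inr (Subtype.ext (congrArg Prod.fst (hlam h)))
  have hy := eq_zero_of_power_sums x y hx (r := r)
    (by simp only [Fintype.card_sum, Fintype.card_fin, Fintype.card_coe]; omega) (by
      intro e he
      have htotal : ∑ u, ∑ j, point lam w j (t, up u) ^ e * c j (t, up u) = 0 :=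
        Finset.sum_eq_zero fun u _ => sum_eq_zero_of_mem_ker hc _ he
      rw [Finset.sum_comm, ← Finset.sum_subset (Finset.subset_univ (insert i U)),
        Finset.sum_insert hiU] at htotal
      · rw [Fintype.sum_sum_type, ← htotal]
        congr 1
        rw [← Finset.sum_coe_sort U]
        refine Finset.sum_congr rfl fun j _ => ?_
        simp only [x, y, Sum.elim_inr, Finset.mul_sum]
        exact Finset.sum_congr rfl fun u _ => by rw [hpt j.1 (hU j.1 j.2)]
      · intro j _ hj
        rw [Finset.mem_insert, not_or] at hj
        rcases hknown j hj.1 hj.2 with h | ⟨hw, h⟩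
        · exact Finset.sum_eq_zero fun u _ => by rw [h, mul_zero]
        · rw [Finset.sum_congr rfl fun u _ => by rw [hpt j hw u], ← Finset.mul_sum]
          rw [show ∑ u, c j (t, up u) = 0 from h a, mul_zero])
  have := hy (Sum.inl (a (w i t, s)))
  simpa [y, up] using this

/-- Node `j` and the nodes outside `D` have colours at place `t` that differ from those of the nodes
in `E`. -/
def Separated (w : Fin n → Fin m → Fin N) (E D : Finset (Fin n)) (j : Fin n) (t : Fin m) : Prop :=
  ∀ i ∈ E, ∀ i' ∈ insert j Dᶜ, i ≠ i' → w i t ≠ w i' t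

open Classical in
/-- The coordinates that node `j` transmits to repair the nodes `ι 0, …, ι (h - 1)`, the `p`-th of
which is repaired with its digit of index `σ p`. -/
noncomputable def transmitted {h : ℕ} (w : Fin n → Fin m → Fin N) (E D : Finset (Fin n))
    (ι : Fin h → Fin n) (σ : Fin h → Fin r) (j : Fin n) : Finset (Fin m × Digits N r) :=
  Finset.univ.filter fun b => Separated w E D j b.1 → ∃ p, b.2 (w (ι p) b.1, σ p) = 0

theorem repair_block {k h d : ℕ} (hn : n = k + r) (hkd : k ≤ d)
    {lam : Fin n × ColourDigits r → F} (hlam : Function.Injective lam)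
    {w : Fin n → Fin m → Fin N} {c : Fin n → Fin m × Digits N r → F}
    (hc : c ∈ LinearMap.ker (parityChecks lam w)) {E D : Finset (Fin n)} (hD : D.card = d)
    (hED : Disjoint E D) (ι : Fin h → Fin n) (hι : Function.Injective ι) (hιE : ∀ p, ι p ∈ E)
    (σ : Fin h → Fin r) (hσ : ∀ p, (σ p).1 = d - k + p.1)
    (hT : ∀ j ∈ D, ∀ t a, (t, a) ∈ transmitted w E D ι σ j →
      ∑ b ∈ face a, c j (t, b) = 0) (p : Fin h) (t : Fin m) (a : Digits N r) :
    c (ι p) (t, a) = 0 := by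
  have hall : ∀ j ∈ D, ¬ Separated w E D j t → ∀ a, c j (t, a) = 0 := by
    intro j hj hs a
    refine congrFun (eq_zero_of_faceSum (fun a => c j (t, a)) fun a => hT j hj t a ?_) a
    simp [transmitted, hs]
  by_cases hsep : ∀ i ∈ E, ∀ i' ∈ Dᶜ, i ≠ i' → w i t ≠ w i' t
  · have main : ∀ q : ℕ, ∀ p : Fin h, p.1 = q → ∀ a, c (ι p) (t, a) = 0 := by
      intro q
      induction q using Nat.strong_induction_on with
      | _ q ih =>
        intro p hp
        have hsub : (Finset.univ.filter fun p' : Fin h => p' ≤ p).image ι ⊆ Dᶜ := by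
          intro j hj
          obtain ⟨p', -, rfl⟩ := Finset.mem_image.1 hj
          exact Finset.mem_compl.2 (Finset.disjoint_left.1 hED (hιE p'))
        -- The nodes still unknown number `n - d - (p + 1)`; together with the `d - k + p + 1`
        -- symbols of `ι p` this makes exactly `r` unknowns.
        refine repair_single hlam hc t (ι p) (σ p)
          (Dᶜ \ (Finset.univ.filter fun p' : Fin h => p' ≤ p).image ι) ?_ ?_ ?_
        · rw [Finset.card_sdiff_of_subset hsub, Finset.card_image_of_injective _ hι, hσ,
            Finset.card_compl, hD, Fintype.card_fin]
          have h1 : (Finset.univ.filter fun p' : Fin h => p' ≤ p).card = p.1 + 1 := by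
            rw [← Fin.card_Iic]; congr 1; ext; simp
          have h2 := Finset.card_le_card hsub
          rw [Finset.card_image_of_injective _ hι, h1, Finset.card_compl, hD,
            Fintype.card_fin] at h2
          rw [h1]
          omega
        · intro j hj
          rw [Finset.mem_sdiff] at hj
          refine (hsep _ (hιE p) j hj.1 ?_).symm
          rintro rfl
          exact hj.2 (Finset.mem_image_of_mem _ (by simp))
        · intro j hji hj
          by_cases hjD : j ∈ D
          · by_cases hs : Separated w E D j t
            · refine Or.inr ⟨(hs _ (hιE p) j (Finset.mem_insert_self _ _) hji.symm).symm, ?_⟩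
              refine digit_sum_eq_zero_of_faceSum (fun a => c j (t, a)) (w (ι p) t, σ p)
                fun a ha => hT j hjD t a ?_
              simp only [transmitted, Finset.mem_filter, Finset.mem_univ, true_and]
              exact fun _ => ⟨p, ha⟩
            · exact Or.inl (hall j hjD hs)
          · left
            have : j ∈ (Finset.univ.filter fun p' : Fin h => p' ≤ p).image ι := by
              by_contra hh
              exact hj (Finset.mem_sdiff.2 ⟨Finset.mem_compl.2 hjD, hh⟩)
            obtain ⟨p', hp', rfl⟩ := Finset.mem_image.1 this
            have hle : p' ≤ p := (Finset.mem_filter.1 hp').2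
            have hlt : p' < p := lt_of_le_of_ne hle fun e => hji (by rw [e])
            exact ih p'.1 (by rw [← hp]; exact hlt) p' rfl
    exact main p.1 p rfl a
  -- A clash between a failed node and a node outside `D` makes every helper send all its symbols at
  -- `t`, so plain erasure decoding suffices.
  · have hns : ∀ j, ¬ Separated w E D j t := fun j hs =>
      hsep fun i hi i' hi' => hs i hi i' (Finset.mem_insert_of_mem hi')
    refine eq_zero_of_erasures hlam hc (t, a) Dᶜ ?_ (fun j hj => ?_) (ι p)
    · rw [Finset.card_compl, hD, Fintype.card_fin]; omega
    · exact hall j (by simpa using hj) (hns j) a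

/-- Separated places cost the fraction `h / (d - k + h)` of a block. Each other place costs a full
block, but comes from an agreement within one of at most `r * (r + 1)` pairs of nodes. -/
theorem card_transmitted_le {h d k M : ℕ} {w : Fin n → Fin m → Fin N}
    (hw : ∀ j j', j ≠ j' → (Finset.univ.filter fun t => w j t = w j' t).card ≤ M)
    {E D : Finset (Fin n)} (hE : E.card ≤ r) (hD : Dᶜ.card ≤ r)
    (hED : Disjoint E D) (ι : Fin h → Fin n) (hι : Function.Injective ι) (hιE : ∀ p, ι p ∈ E)
    (σ : Fin h → Fin r) (hσ : ∀ p, (σ p).1 = d - k + p.1) (j : Fin n) :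
    (transmitted w E D ι σ j).card * (d - k + h) ≤
      m * (h * Fintype.card (Digits N r))
        + r * (r + 1) * M * Fintype.card (Digits N r) * (d - k + h) := by
  classical
  set L := Fintype.card (Digits N r) with hL
  let bad : Finset (Fin m) := Finset.univ.filter fun t => ¬ Separated w E D j t
  have hbad : bad.card ≤ r * (r + 1) * M := by
    have hsub : bad ⊆ ((E ×ˢ insert j Dᶜ).filter fun z => z.1 ≠ z.2).biUnion fun z =>
        Finset.univ.filter fun t => w z.1 t = w z.2 t := by
      intro t ht
      have ht := (Finset.mem_filter.1 ht).2
      unfold Separated at ht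
      push Not at ht
      obtain ⟨i, hi, i', hi', hne, heq⟩ := ht
      refine Finset.mem_biUnion.2 ⟨(i, i'), Finset.mem_filter.2 ⟨Finset.mk_mem_product hi hi', hne⟩,
        by simpa using heq⟩
    refine (Finset.card_le_card hsub).trans
      ((Finset.card_biUnion_le_card_mul _ _ M fun z hz => hw _ _ (Finset.mem_filter.1 hz).2).trans
        (Nat.mul_le_mul_right _ ?_))
    refine (Finset.card_filter_le _ _).trans ?_
    rw [Finset.card_product]
    exact Nat.mul_le_mul hE ((Finset.card_insert_le _ _).trans (by omega))
  have hfib : (transmitted w E D ι σ j).card =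
      ∑ t, (Finset.univ.filter fun a : Digits N r => (t, a) ∈ transmitted w E D ι σ j).card := by
    rw [Finset.card_eq_sum_card_fiberwise (f := Prod.fst) (t := Finset.univ)
      (fun _ _ => Finset.mem_coe.2 (Finset.mem_univ _))]
    refine Finset.sum_congr rfl fun t _ => ?_
    refine Finset.card_nbij' (fun b => b.2) (fun a => (t, a)) ?_ ?_ ?_ ?_
    · rintro ⟨t', a⟩ hb
      simp only [Finset.coe_filter, Set.mem_ofPred_eq] at hb
      obtain ⟨hb, rfl⟩ := hb
      simpa using hb
    · intro a ha
      simpa using ha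
    · rintro ⟨t', a⟩ hb
      simp only [Finset.coe_filter, Set.mem_ofPred_eq] at hb
      rw [hb.2]
    · intro a _
      rfl
  have hblock : ∀ t, (Finset.univ.filter fun a : Digits N r =>
      (t, a) ∈ transmitted w E D ι σ j).card * (d - k + h)
      ≤ h * L + if t ∈ bad then L * (d - k + h) else 0 := by
    intro t
    by_cases hs : Separated w E D j t
    · have hcol : Function.Injective fun p => (w (ι p) t, σ p) := by
        intro p p' hpp
        by_contra hne
        refine hs _ (hιE p) (ι p') (Finset.mem_insert_of_mem ?_) (fun e => hne (hι e))
          (congrArg Prod.fst hpp)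
        exact Finset.mem_compl.2 (Finset.disjoint_left.1 hED (hιE p'))
      have := card_exists_digit_eq_zero (κ := fun g : Fin N × Fin r => g.2.1) (q := d - k)
        (fun p => (w (ι p) t, σ p)) hcol hσ
      refine le_trans (le_of_eq ?_) (Nat.le_add_right _ _)
      rw [hL, ← this]
      congr 2
      ext a
      simp [transmitted, hs]
    · have hb : t ∈ bad := by simpa [bad] using hs
      rw [if_pos hb]
      refine le_trans (Nat.mul_le_mul_right _ (Finset.card_filter_le _ _)) ?_
      rw [Finset.card_univ]
      exact Nat.le_add_left _ _
  rw [hfib, Finset.sum_mul]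
  refine (Finset.sum_le_sum fun t _ => hblock t).trans ?_
  rw [Finset.sum_add_distrib]
  simp only [Finset.sum_const, Finset.card_univ, Fintype.card_fin, smul_eq_mul, ← Finset.sum_filter]
  refine Nat.add_le_add_left ?_ _
  rw [mul_assoc _ L]
  exact Nat.mul_le_mul_right _ (by simpa using hbad)

end HelpByTransfer

/-! ### Change of basis in the nodes, and assembly of the code. -/

namespace HelpByTransfer

theorem exists_points {F : Type} [Finite F] {n r : ℕ}
    (h : Fintype.card (ColourDigits r) * n ≤ Nat.card F) :
    ∃ lam : Fin n × ColourDigits r → F, Function.Injective lam := by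
  classical
  have := Fintype.ofFinite F
  obtain ⟨f⟩ := Function.Embedding.nonempty_of_card_le (α := Fin n × ColourDigits r) (β := F) (by
    rw [Fintype.card_prod, Fintype.card_fin, ← Nat.card_eq_fintype_card (α := F), mul_comm]
    exact h)
  exact ⟨f, f.injective⟩

variable {F : Type} [Field F] {n r N m ℓ : ℕ}

/-- The change of basis in every node, after which the sums over a digit are stored symbols. -/
def encode (e : Fin ℓ ≃ Fin m × Digits N r) :
    (Fin n → Fin m × Digits N r → F) →ₗ[F] (Fin n → Fin ℓ → F) where
  toFun c j x := ∑ b ∈ face (e x).2, c j ((e x).1, b)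
  map_add' c c' := by
    funext j x
    simp [Finset.sum_add_distrib]
  map_smul' z c := by
    funext j x
    simp [Finset.mul_sum]

theorem encode_symm_apply (e : Fin ℓ ≃ Fin m × Digits N r) (c : Fin n → Fin m × Digits N r → F)
    (j : Fin n) (t : Fin m) (a : Digits N r) :
    encode e c j (e.symm (t, a)) = ∑ b ∈ face a, c j (t, b) := by
  simp [encode]

theorem eq_zero_of_encode_node (e : Fin ℓ ≃ Fin m × Digits N r)
    (c : Fin n → Fin m × Digits N r → F) (j : Fin n) (h : encode e c j = 0) : c j = 0 := by
  funext ⟨t, a⟩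
  refine congrFun (eq_zero_of_faceSum (fun a => c j (t, a)) fun a => ?_) a
  rw [← encode_symm_apply e, h, Pi.zero_apply]

theorem encode_node_eq_zero (e : Fin ℓ ≃ Fin m × Digits N r)
    (c : Fin n → Fin m × Digits N r → F) (j : Fin n) (h : ∀ t a, c j (t, a) = 0) :
    encode e c j = 0 := by
  funext x
  exact Finset.sum_eq_zero fun b _ => h _ _

theorem encode_injective (e : Fin ℓ ≃ Fin m × Digits N r) :
    Function.Injective (encode (F := F) (n := n) e) := by
  rw [← LinearMap.ker_eq_bot, LinearMap.ker_eq_bot']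
  intro c hc
  funext j
  exact eq_zero_of_encode_node e c j (congrFun hc j)

/-- There are only `r * ℓ` checks. The matching upper bound on the dimension comes from the MDS
property in `isMDSArrayCode_of_submodule`. -/
theorem le_finrank_ker_parityChecks {k : ℕ} (hn : n = k + r) (e : Fin ℓ ≃ Fin m × Digits N r)
    (lam : Fin n × ColourDigits r → F) (w : Fin n → Fin m → Fin N) :
    ℓ * k ≤ Module.finrank F (LinearMap.ker (parityChecks lam w)) := by
  have hcard : Fintype.card (Fin m × Digits N r) = ℓ := by
    rw [← Fintype.card_congr e, Fintype.card_fin]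
  have h1 := LinearMap.finrank_range_add_finrank_ker (parityChecks lam w)
  have h2 := Submodule.finrank_le (LinearMap.range (parityChecks lam w))
  rw [Module.finrank_pi_fintype] at h1 h2
  simp only [Module.finrank_fintype_fun_eq_card, hcard, Finset.sum_const, Finset.card_univ,
    Fintype.card_fin, smul_eq_mul] at h1 h2
  subst hn
  nlinarith

theorem existsSimultaneousCode_of_points [Finite F] {k M : ℕ} (hn : n = k + r)
    (e : Fin ℓ ≃ Fin m × Digits N r) {lam : Fin n × ColourDigits r → F}
    (hlam : Function.Injective lam) {w : Fin n → Fin m → Fin N}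
    (hw : ∀ j j', j ≠ j' → (Finset.univ.filter fun t => w j t = w j' t).card ≤ M)
    {ε : ℝ} (hε : 0 < ε) (hM : (r : ℝ) * (r + 1) * M * r ≤ ε * m) :
    ExistsSimultaneousCode F n k ℓ ε := by
  have hℓ : m * Fintype.card (Digits N r) = ℓ := by
    rw [← Fintype.card_fin m, ← Fintype.card_prod, ← Fintype.card_congr e, Fintype.card_fin]
  refine ⟨(LinearMap.ker (parityChecks lam w)).map (encode e), ?_, ?_⟩
  · refine isMDSArrayCode_of_submodule (by omega) _ ?_ ?_
    · rw [← (Submodule.equivMapOfInjective _ (encode_injective e) _).finrank_eq]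
      exact le_finrank_ker_parityChecks hn e lam w
    · rintro S hS _ ⟨c, hc, rfl⟩ h
      have hc0 : c = 0 := by
        funext i b
        refine eq_zero_of_erasures hlam hc b Sᶜ ?_ (fun j hj => ?_) i
        · rw [Finset.card_compl, hS, Fintype.card_fin]; omega
        · exact congrFun (eq_zero_of_encode_node e c j (h j (by simpa using hj))) b
      rw [hc0, map_zero]
  · intro h d hh hhr hkd hd E D hE hD hED
    let ι : Fin h → Fin n := fun p => ((E.equivFinOfCardEq hE).symm p).1
    have hι : Function.Injective ι := fun p p' hpp =>
      (E.equivFinOfCardEq hE).symm.injective (Subtype.ext hpp)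
    have hιE : ∀ p, ι p ∈ E := fun p => Subtype.property _
    have hιsurj : ∀ i ∈ E, ∃ p, ι p = i := fun i hi =>
      ⟨E.equivFinOfCardEq hE ⟨i, hi⟩, by simp [ι]⟩
    -- The index stays below `r` because `d ≤ n - h` means `d - k + h ≤ r`.
    let σ : Fin h → Fin r := fun p => ⟨d - k + p.1, by have := p.2; omega⟩
    refine ⟨fun j => (transmitted w E D ι σ j).map e.symm.toEmbedding, fun j _ => ?_, ?_⟩
    · rw [Finset.card_map]
      have hcard := card_transmitted_le hw (E := E) (D := D) (by omega)
        (by rw [Finset.card_compl, hD, Fintype.card_fin]; omega) hED ι hι hιE σ (fun _ => rfl) j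
      set L := Fintype.card (Digits N r) with hL
      set X := (transmitted w E D ι σ j).card
      have hcast : ((d - k + h : ℕ) : ℝ) = (d : ℝ) - k + h := by
        push_cast [Nat.cast_sub hkd]; ring
      have hs : (0 : ℝ) < (d : ℝ) - k + h := by
        rw [← hcast]; exact_mod_cast (by omega : 0 < d - k + h)
      have hsr : (d : ℝ) - k + h ≤ r := by
        rw [← hcast]; exact_mod_cast (by omega : d - k + h ≤ r)
      have hcardR : (X : ℝ) * ((d : ℝ) - k + h) ≤
          m * (h * L) + r * (r + 1) * M * L * ((d : ℝ) - k + h) := by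
        rw [← hcast]; exact_mod_cast hcard
      rw [← mul_div_assoc, le_div_iff₀ hs, ← hℓ]
      refine hcardR.trans ?_
      push_cast
      have hh1 : (1 : ℝ) ≤ h := by exact_mod_cast hh
      -- The clash term must fit into `ε * h * m * L`; the worst case is `d - k + h = r` and `h =
      -- 1`.
      have h1 : (r : ℝ) * (r + 1) * M * L * ((d : ℝ) - k + h) ≤ r * (r + 1) * M * L * r :=
        mul_le_mul_of_nonneg_left hsr (by positivity)
      have h2 : (r : ℝ) * (r + 1) * M * L * r ≤ ε * m * L := by
        calc (r : ℝ) * (r + 1) * M * L * r = r * (r + 1) * M * r * L := by ring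
          _ ≤ ε * m * L := mul_le_mul_of_nonneg_right hM (by positivity)
      have h3 : ε * m * L * 1 ≤ ε * m * L * h :=
        mul_le_mul_of_nonneg_left hh1 (by positivity)
      linarith
    · refine repairsByTransfer_of_submodule _ E D _ ?_
      rintro _ ⟨c, hc, rfl⟩ hT i hi
      obtain ⟨p, rfl⟩ := hιsurj i hi
      refine encode_node_eq_zero e c _ fun t a =>
        repair_block hn hkd hlam hc hD hED ι hι hιE σ (fun _ => rfl) (fun j hj t a ha => ?_) p t a
      rw [← encode_symm_apply e]
      exact hT j hj _ (Finset.mem_map_of_mem e.symm.toEmbedding ha)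

end HelpByTransfer

theorem theorem4 (r : ℕ) (hr : 1 ≤ r) (ε : ℝ) (hε : 0 < ε) :
    ∃ θ : ℝ, 0 < θ ∧ ∃ c : ℝ, 0 < c ∧ ∃ K : ℕ,
      {ℓ : ℕ | ∃ n k : ℕ, 1 ≤ k ∧ n = k + r ∧ c * Real.exp (θ * (ℓ : ℝ)) ≤ (n : ℝ) ∧
        (∃ (F : Type) (_ : Field F) (_ : Finite F),
          Nat.card F ≤ K * n ∧ ExistsSimultaneousCode F n k ℓ ε) ∧
        (∀ (F : Type) [Field F] [Finite F],
          K * n ≤ Nat.card F → ExistsSimultaneousCode F n k ℓ ε)}.Infinite := by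
  -- Since `m = b * M`, this ratio `b` makes the clashing places affordable for every `M`, while the
  -- `4 ^ b` colours keep `L` constant.
  obtain ⟨b, hbε⟩ := exists_nat_ge ((r : ℝ) * (r + 1) * r / ε)
  rw [div_le_iff₀ hε] at hbε
  have hb : 1 ≤ b := by
    rcases Nat.eq_zero_or_pos b with rfl | h
    · have : (0 : ℝ) < r := by exact_mod_cast hr
      have : (0 : ℝ) < (r : ℝ) * (r + 1) * r := by positivity
      simp only [Nat.cast_zero, zero_mul] at hbε
      linarith
    · exact h
  set L := Fintype.card (HelpByTransfer.Digits (4 ^ b) r) with hL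
  have hL0 : 0 < L := Fintype.card_pos
  set Q := Fintype.card (HelpByTransfer.ColourDigits r) with hQ
  have hQ0 : 0 < Q := Fintype.card_pos
  -- Since `ℓ = m * L`, this exponent gives `exp (θ * ℓ) = 2 ^ m = n`. The factor `2` in `K` leaves
  -- room for a prime from Bertrand's postulate.
  refine ⟨Real.log 2 / L, div_pos (Real.log_pos one_lt_two) (by exact_mod_cast hL0), 1, one_pos,
    2 * Q, ?_⟩
  refine Set.infinite_of_injective_forall_mem (f := fun x : ℕ => b * (r + x) * L) ?_ fun x => ?_
  · intro x y hxy
    have := Nat.eq_of_mul_eq_mul_left hb (Nat.eq_of_mul_eq_mul_right hL0 hxy)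
    omega
  -- The shift by `r` ensures `r < 2 ^ m`, hence `k ≥ 1`.
  · set M := r + x with hM
    set m := b * M with hm
    have hrn : r < 2 ^ m :=
      lt_of_le_of_lt ((Nat.le_add_right r x).trans (Nat.le_mul_of_pos_left _ hb)) Nat.lt_two_pow_self
    obtain ⟨w, hw⟩ := HelpByTransfer.exists_code_few_agreements b M hb
    have hcode : ∀ (F : Type) [Field F] [Finite F], Q * 2 ^ m ≤ Nat.card F →
        ExistsSimultaneousCode F (2 ^ m) (2 ^ m - r) (m * L) ε := by
      intro F _ _ hF
      obtain ⟨lam, hlam⟩ := HelpByTransfer.exists_points hF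
      refine HelpByTransfer.existsSimultaneousCode_of_points (by omega)
        (Fintype.equivOfCardEq (by rw [Fintype.card_prod, Fintype.card_fin, Fintype.card_fin]))
        hlam (fun j j' hjj => (hw j j' hjj).le) hε ?_
      push_cast
      have := mul_le_mul_of_nonneg_right hbε (Nat.cast_nonneg (α := ℝ) M)
      linarith
    refine ⟨2 ^ m, 2 ^ m - r, by omega, by omega, ?_, ?_, ?_⟩
    · have hLR : (L : ℝ) ≠ 0 := by exact_mod_cast hL0.ne'
      refine le_of_eq ?_
      rw [one_mul, Nat.cast_mul, show Real.log 2 / L * ((m : ℝ) * L) = Real.log 2 * m by field_simp,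
        Real.exp_mul, Real.exp_log two_pos, Real.rpow_natCast]
      push_cast
      rfl
    · obtain ⟨p, hp, hlt, hle⟩ := Nat.exists_prime_lt_and_le_two_mul (Q * 2 ^ m) (by positivity)
      have : Fact p.Prime := ⟨hp⟩
      refine ⟨ZMod p, inferInstance, inferInstance, ?_, hcode (ZMod p) ?_⟩
      · rw [Nat.card_zmod]
        linarith
      · rw [Nat.card_zmod]
        exact hlt.le
    · intro F _ _ hF
      refine hcode F (le_trans ?_ hF)
      exact Nat.mul_le_mul_right _ (by omega)
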